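/- Let $\mathcal{O}$ be a discrete valuation ring in which $2$ is invertible, and let $\pi$ be a uniformizer of $\mathcal{O}$ (for instance $\mathcal{O}=\mathcal{O}_{\breve F}$, where $\breve F$ is the completion of the maximal unramified extension of a finite extension $F$ of $\mathbb{Q}_p$, $p\neq 2$). Let $d=2n$ and $l=2r$ be even integers with $d\ge 5$, $l>1$ and $d-l>1$. Let $S=\mathcal{O}[(x_{i,j})_{1\le i,j\le d}]$, let $X=(x_{i,j})$ be the generic $d\times d$ matrix, and write it in blocks $$X=\begin{pmatrix}E_1&O_1&E_2\\ B_1&A&B_2\\ E_3&O_2&E_4\end{pmatrix}$$ with row and column blocks of sizes $n-r,\ l,\ n-r$. Let $J_m$ be the unit antidiagonal $m\times m$ matrix and put $$S_0=\begin{pmatrix}0&0&J_{n-r}\\0&0&0\\J_{n-r}&0&0\end{pmatrix},\qquad S_1=\begin{pmatrix}0&0&0\\0&J_l&0\\0&0&0\end{pmatrix}.$$ Let $I^{\rm naive}\subset S$ be the ideal generated by the entries of $X^2$, the $2\times 2$ minors of $X$, and the entries of $X^tS_0X-2\pi(S_0X+\pi S_1X)$ and of $X^tS_1X+2(S_0X+\pi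 S_1X)$. Let $I^{\rm add}\subset S$ be the ideal generated by $\mathrm{Tr}(X)$, $\mathrm{Tr}(A)+2\pi$, and the entries of $AJ_l-J_lA^t$ and of $B_2J_{n-r}B_1^t-AJ_l$. Put $I=I^{\rm naive}+I^{\rm add}$ and $U_{d,l}=\mathrm{Spec}(S/I)$. Then: 1. $U_{d,l}$ is flat over $\mathcal{O}$; 2. $\pi$ is a nonzerodivisor in $S/I$; 3. $I$ cuts out the flat closure of the naive chart $\mathrm{Spec}(S/I^{\rm naive})$ away from the zero section $X=0$: $I$ is the ideal of the scheme-theoretic closure in $\mathrm{Spec}(S)$ of the open subscheme of $\mathrm{Spec}(S/I^{\rm naive})$ on which $\pi$ is invertible and $X\neq 0$, that is, $$I=\bigcap_{i,j}\ker\Big(S\to (S/I^{\rm naive})\big[\tfrac{1}{\pi x_{i,j}}\big]\Big).$$ -/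

import Mathlib

namespace OrthogonalChart

/-- Row/column index set of a `d × d` matrix, `d = l + 2m`, cut into consecutive blocks of
sizes `m`, `l`, `m`. -/
abbrev Idx (m l : ℕ) : Type := Fin m ⊕ (Fin l ⊕ Fin m)

/-- Positions `1, …, m`. -/
abbrev fstIdx (m l : ℕ) : Fin m → Idx m l := Sum.inl

/-- Positions `m + 1, …, m + l`. -/
abbrev midIdx (m l : ℕ) : Fin l → Idx m l := fun i => Sum.inr (Sum.inl i)

/-- Positions `m + l + 1, …, d`. -/
abbrev lstIdx (m l : ℕ) : Fin m → Idx m l := fun i => Sum.inr (Sum.inr i)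

section Matrices

variable (R : Type*) [CommRing R]

/-- The unit antidiagonal matrix `J_k`. -/
def antidiag (k : ℕ) : Matrix (Fin k) (Fin k) R :=
  Matrix.of fun i j => if j = i.rev then 1 else 0

/-- `S₀`: antidiagonal, with ones in the two outer blocks and zeros in the middle one. -/
def S₀ (m l : ℕ) : Matrix (Idx m l) (Idx m l) R :=
  Matrix.of fun i j =>
    match i, j with
    | Sum.inl a, Sum.inr (Sum.inr b) => antidiag R m a b
    | Sum.inr (Sum.inr a), Sum.inl b => antidiag R m a b
    | _, _ => 0

/-- `S₁`: antidiagonal, with zeros in the two outer blocks and ones in the middle one. -/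
def S₁ (m l : ℕ) : Matrix (Idx m l) (Idx m l) R :=
  Matrix.of fun i j =>
    match i, j with
    | Sum.inr (Sum.inl a), Sum.inr (Sum.inl b) => antidiag R l a b
    | _, _ => 0

variable {R}

/-- The set of entries of a matrix. -/
def entries {ι κ : Type*} (M : Matrix ι κ R) : Set R :=
  Set.range fun p : ι × κ => M p.1 p.2

/-- The set of `2 × 2` minors of a matrix (`∧² M`). -/
def minors₂ {ι κ : Type*} (M : Matrix ι κ R) : Set R :=
  Set.range fun p : (ι × ι) × (κ × κ) =>
    M p.1.1 p.2.1 * M p.1.2 p.2.2 - M p.1.1 p.2.2 * M p.1.2 p.2.1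

/-- The ideal of the scheme-theoretic closure in `Spec R` of the open subscheme `g ≠ 0` of
`Spec (R ⧸ J)`: the kernel of `R → (R ⧸ J)[1/g]`. -/
def closureIdeal (J : Ideal R) (g : R) : Ideal R :=
  RingHom.ker
    ((algebraMap (R ⧸ J) (Localization.Away (Ideal.Quotient.mk J g))).comp (Ideal.Quotient.mk J))

end Matrices

section Chart

variable (𝒪 : Type*) [CommRing 𝒪] (m l : ℕ)

/-- `S = 𝒪[(x_{i,j})_{1 ≤ i, j ≤ d}]`. -/
abbrev PolyRing : Type _ := MvPolynomial (Idx m l × Idx m l) 𝒪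

/-- The generic matrix `X = (x_{i,j})`. -/
noncomputable def genericX : Matrix (Idx m l) (Idx m l) (PolyRing 𝒪 m l) :=
  Matrix.of fun i j => MvPolynomial.X (i, j)

/-- The middle block `A` of `X`. -/
noncomputable def blockA : Matrix (Fin l) (Fin l) (PolyRing 𝒪 m l) :=
  (genericX 𝒪 m l).submatrix (midIdx m l) (midIdx m l)

/-- The block `B₁` of `X` (middle rows, first columns). -/
noncomputable def blockB₁ : Matrix (Fin l) (Fin m) (PolyRing 𝒪 m l) :=
  (genericX 𝒪 m l).submatrix (midIdx m l) (fstIdx m l)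

/-- The block `B₂` of `X` (middle rows, last columns). -/
noncomputable def blockB₂ : Matrix (Fin l) (Fin m) (PolyRing 𝒪 m l) :=
  (genericX 𝒪 m l).submatrix (midIdx m l) (lstIdx m l)

variable {𝒪} (π : 𝒪)

open scoped Matrix in
/-- `I^naive`, generated by the entries of `X²`, the `2 × 2` minors of `X`, and the entries of
`Xᵗ S₀ X - 2π (S₀ X + π S₁ X)` and `Xᵗ S₁ X + 2 (S₀ X + π S₁ X)`. -/
noncomputable def naiveIdeal : Ideal (PolyRing 𝒪 m l) :=
  let X := genericX 𝒪 m l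
  let T₀ := S₀ (PolyRing 𝒪 m l) m l
  let T₁ := S₁ (PolyRing 𝒪 m l) m l
  let ϖ : PolyRing 𝒪 m l := MvPolynomial.C π
  Ideal.span
    (entries (X * X) ∪ minors₂ X ∪
      entries (Xᵀ * T₀ * X - (2 * ϖ) • (T₀ * X + ϖ • (T₁ * X))) ∪
      entries (Xᵀ * T₁ * X + (2 : PolyRing 𝒪 m l) • (T₀ * X + ϖ • (T₁ * X))))

open scoped Matrix in
/-- `I^add`, generated by `Tr X`, `Tr A + 2π` and the entries of `A J_l - J_l Aᵗ` and
`B₂ J_m B₁ᵗ - A J_l`. -/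
noncomputable def addIdeal : Ideal (PolyRing 𝒪 m l) :=
  let A := blockA 𝒪 m l
  let B₁ := blockB₁ 𝒪 m l
  let B₂ := blockB₂ 𝒪 m l
  let Jl := antidiag (PolyRing 𝒪 m l) l
  let Jm := antidiag (PolyRing 𝒪 m l) m
  Ideal.span
    ({(genericX 𝒪 m l).trace} ∪ {A.trace + 2 * MvPolynomial.C π} ∪
      entries (A * Jl - Jl * Aᵀ) ∪ entries (B₂ * Jm * B₁ᵀ - A * Jl))

/-- `I = I^naive + I^add`. -/
noncomputable def chartIdeal : Ideal (PolyRing 𝒪 m l) :=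
  naiveIdeal m l π + addIdeal m l π

/-- The coordinate ring `S ⧸ I`. -/
abbrev ChartRing : Type _ := PolyRing 𝒪 m l ⧸ chartIdeal m l π

/-- The affine chart `U = Spec (S ⧸ I)`. -/
noncomputable def chart : AlgebraicGeometry.Scheme :=
  AlgebraicGeometry.Spec (CommRingCat.of (ChartRing m l π))

/-- The structure morphism `U ⟶ Spec 𝒪`. -/
noncomputable def chartStructure :
    chart m l π ⟶ AlgebraicGeometry.Spec (CommRingCat.of 𝒪) :=
  AlgebraicGeometry.Spec.map (CommRingCat.ofHom (algebraMap 𝒪 (ChartRing m l π)))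

end Chart

end OrthogonalChart

/-!
The chart is the family of rank-one matrices `z wᵗ` in disguise. Put `s = uᵗ J u` and
`t = v₁ᵗ J v₂`. With `z = (-(s/2) J v₂, u, -(s/2) J v₁)` and `w = (v₁, t J u, v₂)`, all equations
of the chart reduce to the single equation `q := s t + 2π = 0`, so `S/I` maps to `𝒪[u, v]/(q)`.
Conversely, the equations express every entry of `X` through the products `u_a v_b` in the outer
part of the middle rows, and these satisfy only the Segre relations; so `𝒪[u, v] → S/I`, sending a
monomial to the product of the corresponding `u_a v_b` (and to `0` if it is not balanced), is
linear over `S`, kills `q`, and splits that map. Restricted to a line in a direction `ξ` with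
`s(ξ) t(ξ) = 1` the polynomial `q` is monic, which makes `𝒪[u, v]/(q)`, and hence its direct summand
`S/I`, flat.

Where `π` and an entry `X i j` are invertible, the naive equations force `∑ₐ X a j * X (rev a) j`
(over the middle rows) to be a unit, and cancelling it gives the additional equations. Since
`2π = -Tr A` lies in the ideal of the entries of `X` and is a nonzerodivisor of the flat algebra
`S/I`, nothing nonzero in `S/I` vanishes on all these loci.
-/

namespace OrthogonalChart

open scoped Matrix

section Flatness

open Polynomial

theorem flat_quotient_span_singleton_of_monic {R A : Type*} [CommRing R] [CommRing A]
    [Algebra R A] [Module.Flat R A] (θ : A →ₐ[R] A[X]) (hθ : ∀ a, (θ a).eval 0 = a) {q : A}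
    (hq : (θ q).Monic) : Module.Flat R (A ⧸ Ideal.span {q}) := by
  have : Module.Free A (A[X] ⧸ Ideal.span {θ q}) := hq.free_quotient
  have : Module.Flat R (A[X] ⧸ Ideal.span {θ q}) := Module.Flat.trans R A _
  let ev : A[X] →ₐ[R] A := (aeval (0 : A)).restrictScalars R
  have hev (a : A) : ev (θ a) = a := (coe_aeval_eq_eval (0 : A) ▸ hθ a :)
  let i := Ideal.quotientMapₐ (Ideal.span {θ q}) θ (I := Ideal.span {q}) <| by
    rw [Ideal.span_singleton_le_iff_mem]
    exact Ideal.mem_span_singleton_self _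
  let r := Ideal.quotientMapₐ (Ideal.span {q}) ev (I := Ideal.span {θ q}) <| by
    rw [Ideal.span_singleton_le_iff_mem, Ideal.mem_comap]
    exact (hev q).symm ▸ Ideal.mem_span_singleton_self _
  refine .of_retract i.toLinearMap r.toLinearMap (LinearMap.ext fun x => ?_)
  obtain ⟨a, rfl⟩ := Ideal.Quotient.mk_surjective x
  exact congrArg (Ideal.Quotient.mk _) (hev a)

theorem monic_dotProduct_line {R ι : Type*} [CommRing R] [Nontrivial R] [Fintype ι]
    {x y ξ η : ι → R} (h : ξ ⬝ᵥ η = 1) {p : R[X]}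
    (hp : p = (fun i => C (x i) + C (ξ i) * X) ⬝ᵥ fun i => C (y i) + C (η i) * X) :
    p.Monic ∧ p.natDegree = 2 := by
  have expand : p = C 1 * X ^ 2 + C (x ⬝ᵥ η + ξ ⬝ᵥ y) * X + C (x ⬝ᵥ y) := by
    rw [hp, ← h]
    simp only [dotProduct, map_add, map_sum, map_mul, add_mul, Finset.sum_mul,
      ← Finset.sum_add_distrib]
    exact Finset.sum_congr rfl fun i _ => by ring
  rw [expand]
  exact ⟨leadingCoeff_quadratic one_ne_zero, natDegree_quadratic one_ne_zero⟩

end Flatness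

section Segre

variable {α β R : Type*} [CommRing R]

/-- A matrix has rank at most one, in the sense that all its `2 × 2` minors vanish. -/
def MinorsVanish (Y : α → β → R) : Prop :=
  ∀ a a' b b', Y a b * Y a' b' = Y a b' * Y a' b

theorem MinorsVanish.flip {Y : α → β → R} (hY : MinorsVanish Y) : MinorsVanish (flip Y) :=
  fun b b' a a' => (hY a a' b b').trans (mul_comm _ _)

theorem MinorsVanish.prod_zipWith_perm_right {Y : α → β → R} (hY : MinorsVanish Y)
    {t t' : List β} (h : t.Perm t') (s : List α) (hs : s.length = t.length) :
    (List.zipWith Y s t).prod = (List.zipWith Y s t').prod := by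
  induction h generalizing s with
  | nil => rfl
  | cons b _ ih =>
    obtain _ | ⟨a, s⟩ := s
    · rfl
    · rw [List.zipWith_cons_cons, List.zipWith_cons_cons, List.prod_cons, List.prod_cons,
        ih s (by simpa using hs)]
  | swap b b' t =>
    obtain _ | ⟨a, _ | ⟨a', s⟩⟩ := s
    · rfl
    · simp at hs
    · simp only [List.zipWith_cons_cons, List.prod_cons, ← mul_assoc]
      rw [hY]
  | trans h₁ _ ih₁ ih₂ => exact (ih₁ s hs).trans (ih₂ s (hs.trans h₁.length_eq))

theorem MinorsVanish.prod_zipWith_perm {Y : α → β → R} (hY : MinorsVanish Y)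
    {s s' : List α} {t t' : List β} (hs : s.Perm s') (ht : t.Perm t')
    (h : s.length = t.length) : (List.zipWith Y s t).prod = (List.zipWith Y s' t').prod := by
  rw [hY.prod_zipWith_perm_right ht s h, List.zipWith_comm,
    List.zipWith_comm (f := Y) (as := s')]
  exact hY.flip.prod_zipWith_perm_right hs t' (by rw [← ht.length_eq, h])

/-- The product of the entries of `Y` along a pairing of the row indices `s` with the column
indices `t`, and `0` if there is no such pairing. If the `2 × 2` minors of `Y` vanish it does not
depend on the pairing. -/
noncomputable def pairingProd (Y : α → β → R) (s : Multiset α) (t : Multiset β) : R :=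
  if s.card = t.card then (List.zipWith Y s.toList t.toList).prod else 0

theorem pairingProd_zero (Y : α → β → R) : pairingProd Y 0 0 = 1 := by
  simp [pairingProd]

theorem MinorsVanish.pairingProd_cons {Y : α → β → R} (hY : MinorsVanish Y) (a : α) (b : β)
    (s : Multiset α) (t : Multiset β) :
    pairingProd Y (a ::ₘ s) (b ::ₘ t) = Y a b * pairingProd Y s t := by
  unfold pairingProd
  by_cases h : s.card = t.card
  · rw [if_pos (by simp [h]), if_pos h, ← List.prod_cons, ← List.zipWith_cons_cons]
    refine hY.prod_zipWith_perm ?_ ?_ (by simp [h]) <;>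
    · rw [← Multiset.coe_eq_coe]
      simp [← Multiset.cons_coe]
  · rw [if_neg (by simpa using h), if_neg h, mul_zero]

variable (𝒪 : Type*) [CommRing 𝒪] [Algebra 𝒪 R]

/-- The linear map sending a monomial in row and column variables to the product of the entries
of `Y` along a pairing of its row variables with its column variables. -/
noncomputable def segreRetraction (Y : α → β → R) : MvPolynomial (α ⊕ β) 𝒪 →ₗ[𝒪] R :=
  (MvPolynomial.basisMonomials (α ⊕ β) 𝒪).constr 𝒪 fun c =>
    pairingProd Y (c.toMultiset.filterMap Sum.getLeft?) (c.toMultiset.filterMap Sum.getRight?)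

theorem segreRetraction_monomial (Y : α → β → R) (c : α ⊕ β →₀ ℕ) :
    segreRetraction 𝒪 Y (MvPolynomial.monomial c 1) =
      pairingProd Y (c.toMultiset.filterMap Sum.getLeft?)
        (c.toMultiset.filterMap Sum.getRight?) := by
  have := (MvPolynomial.basisMonomials (α ⊕ β) 𝒪).constr_basis 𝒪 (fun c =>
    pairingProd Y (c.toMultiset.filterMap Sum.getLeft?) (c.toMultiset.filterMap Sum.getRight?)) c
  simpa only [segreRetraction, MvPolynomial.coe_basisMonomials] using this

theorem segreRetraction_one (Y : α → β → R) : segreRetraction 𝒪 Y 1 = 1 := by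
  rw [← MvPolynomial.C_1, ← MvPolynomial.monomial_zero', segreRetraction_monomial]
  simp only [Finsupp.toMultiset_zero, Multiset.filterMap_zero, pairingProd_zero]

theorem MinorsVanish.segreRetraction_X_mul_X_mul {Y : α → β → R} (hY : MinorsVanish Y)
    (a : α) (b : β) (g : MvPolynomial (α ⊕ β) 𝒪) :
    segreRetraction 𝒪 Y (MvPolynomial.X (Sum.inl a) * MvPolynomial.X (Sum.inr b) * g) =
      Y a b * segreRetraction 𝒪 Y g := by
  suffices h : segreRetraction 𝒪 Y ∘ₗ LinearMap.mulLeft 𝒪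
      (MvPolynomial.X (Sum.inl a) * MvPolynomial.X (Sum.inr b)) =
      LinearMap.mulLeft 𝒪 (Y a b) ∘ₗ segreRetraction 𝒪 Y from LinearMap.congr_fun h g
  refine (MvPolynomial.basisMonomials (α ⊕ β) 𝒪).ext fun c => ?_
  simp only [MvPolynomial.coe_basisMonomials, LinearMap.comp_apply, LinearMap.mulLeft_apply,
    MvPolynomial.X, MvPolynomial.monomial_mul, one_mul, segreRetraction_monomial]
  rw [← hY.pairingProd_cons, Finsupp.toMultiset_add, Finsupp.toMultiset_add,
    Finsupp.toMultiset_single, Finsupp.toMultiset_single, one_smul, one_smul,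
    Multiset.singleton_add, Multiset.cons_add, Multiset.singleton_add,
    Multiset.filterMap_cons_some Sum.getLeft? (Sum.inl a) (b := a) _ rfl,
    Multiset.filterMap_cons_none (Sum.inr b) _ rfl,
    Multiset.filterMap_cons_none (Sum.inl a) _ rfl,
    Multiset.filterMap_cons_some Sum.getRight? (Sum.inr b) (b := b) _ rfl]

variable {𝒪} {P : Type*} [CommRing P] [Algebra 𝒪 P]

/-- The pairs `(p, r)` such that the linear map `σ` turns multiplication by `p` into
multiplication by `r`; being a subalgebra, it is a device for proving linearity of `σ` over a
ring by checking generators. -/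
def intertwiners (σ : P →ₗ[𝒪] R) : Subalgebra 𝒪 (P × R) where
  carrier := {x | ∀ g, σ (x.1 * g) = x.2 * σ g}
  mul_mem' {x y} hx hy g := by rw [Prod.fst_mul, Prod.snd_mul, mul_assoc, hx, hy, mul_assoc]
  add_mem' {x y} hx hy g := by rw [Prod.fst_add, Prod.snd_add, add_mul, map_add, hx, hy, add_mul]
  algebraMap_mem' c g := by simp [← Algebra.smul_def]

end Segre

section Forms

variable {m l : ℕ} {R : Type*} [CommRing R]

theorem antidiag_mul {ι : Type*} {k : ℕ} (M : Matrix (Fin k) ι R) (i : Fin k) (j : ι) :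
    (antidiag R k * M) i j = M i.rev j := by
  simp [antidiag, Matrix.mul_apply]

theorem mul_antidiag {ι : Type*} {k : ℕ} (M : Matrix ι (Fin k) R) (i : ι) (j : Fin k) :
    (M * antidiag R k) i j = M i j.rev := by
  simp [antidiag, Matrix.mul_apply, Fin.rev_eq_iff, eq_comm (a := j)]

theorem S₀_mulVec (z : Idx m l → R) : S₀ R m l *ᵥ z =
    Sum.elim (fun a => z (lstIdx m l a.rev))
      (Sum.elim (fun _ => 0) fun a => z (fstIdx m l a.rev)) := by
  ext (a | a | a) <;> simp [S₀, antidiag, Matrix.mulVec, dotProduct]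

theorem S₁_mulVec (z : Idx m l → R) :
    S₁ R m l *ᵥ z =
      Sum.elim (fun _ => 0) (Sum.elim (fun a => z (midIdx m l a.rev)) fun _ => 0) := by
  ext (a | a | a) <;> simp [S₁, antidiag, Matrix.mulVec, dotProduct]

theorem sum_mul_rev_comm {k : ℕ} (f g : Fin k → R) : ∑ a, f a * g a.rev = ∑ a, g a * f a.rev := by
  rw [← Equiv.sum_comp Fin.revPerm]
  simp only [Fin.revPerm_apply, Fin.rev_rev, mul_comm]

theorem dotProduct_S₀_mulVec (y z : Idx m l → R) : y ⬝ᵥ S₀ R m l *ᵥ z =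
    ∑ a, y (fstIdx m l a) * z (lstIdx m l a.rev) +
      ∑ a, z (fstIdx m l a) * y (lstIdx m l a.rev) := by
  rw [sum_mul_rev_comm (fun a => z (fstIdx m l a)) fun a => y (lstIdx m l a)]
  simp [S₀_mulVec, dotProduct]

theorem dotProduct_S₁_mulVec (y z : Idx m l → R) :
    y ⬝ᵥ S₁ R m l *ᵥ z = ∑ a, y (midIdx m l a) * z (midIdx m l a.rev) := by
  simp [S₁_mulVec, dotProduct]

/-- The entries of `Xᵗ S₁ X`. -/
def midForm (X : Matrix (Idx m l) (Idx m l) R) (i j : Idx m l) : R :=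
  ∑ a, X (midIdx m l a) i * X (midIdx m l a.rev) j

variable {X : Matrix (Idx m l) (Idx m l) R}

theorem midForm_comm (i j : Idx m l) : midForm X i j = midForm X j i :=
  sum_mul_rev_comm (fun a => X (midIdx m l a) i) fun a => X (midIdx m l a) j

theorem MinorsVanish.midForm_mul_apply (hX : MinorsVanish X) (i j k a : Idx m l) :
    midForm X i j * X a k = midForm X k j * X a i := by
  rw [midForm, midForm, Finset.sum_mul, Finset.sum_mul]
  refine Finset.sum_congr rfl fun b _ => ?_
  linear_combination X (midIdx m l b.rev) j * hX (midIdx m l b) a i k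

theorem MinorsVanish.midForm_mul_midForm (hX : MinorsVanish X) (i j k : Idx m l) :
    midForm X i j * midForm X k j = midForm X j j * midForm X i k := by
  rw [midForm_comm k j, midForm.eq_def X j k, midForm.eq_def X i k, Finset.mul_sum,
    Finset.mul_sum]
  refine Finset.sum_congr rfl fun b _ => ?_
  rw [← mul_assoc, ← mul_assoc, hX.midForm_mul_apply j]

end Forms

section Relations

variable {m l : ℕ} {R : Type*} [CommRing R] {X : Matrix (Idx m l) (Idx m l) R} {π : R}

/-- The equations of the naive chart, for a matrix over any ring. -/
structure NaiveRel (X : Matrix (Idx m l) (Idx m l) R) (π : R) : Prop where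
  sq : X * X = 0
  minors : MinorsVanish X
  form₀ : Xᵀ * S₀ R m l * X - (2 * π) • (S₀ R m l * X + π • (S₁ R m l * X)) = 0
  form₁ : Xᵀ * S₁ R m l * X + (2 : R) • (S₀ R m l * X + π • (S₁ R m l * X)) = 0

/-- The additional equations of the chart, for the entries of a matrix over any ring. -/
structure AddRel (X : Matrix (Idx m l) (Idx m l) R) (π : R) : Prop where
  trace : X.trace = 0
  trace_mid : ∑ a, X (midIdx m l a) (midIdx m l a) + 2 * π = 0
  symm a b : X (midIdx m l a) (midIdx m l b.rev) = X (midIdx m l b) (midIdx m l a.rev)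
  mid a b : ∑ k, X (midIdx m l a) (lstIdx m l k.rev) * X (midIdx m l b) (fstIdx m l k) =
    X (midIdx m l a) (midIdx m l b.rev)

theorem transpose_mul_S₀_mul_apply (i j : Idx m l) : (Xᵀ * S₀ R m l * X) i j =
    ∑ a, X (fstIdx m l a) i * X (lstIdx m l a.rev) j +
      ∑ a, X (fstIdx m l a) j * X (lstIdx m l a.rev) i :=
  (Matrix.mul_mul_apply ..).trans (dotProduct_S₀_mulVec ..)

theorem transpose_mul_S₁_mul_apply (i j : Idx m l) : (Xᵀ * S₁ R m l * X) i j = midForm X i j :=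
  (Matrix.mul_mul_apply ..).trans (dotProduct_S₁_mulVec ..)

namespace NaiveRel

variable (hX : NaiveRel X π)
include hX

theorem midForm_eq (i j : Idx m l) : midForm X i j =
    -(2 * ((S₀ R m l *ᵥ X.col j) i + π * (S₁ R m l *ᵥ X.col j) i)) := by
  rw [← transpose_mul_S₁_mul_apply, eq_neg_iff_add_eq_zero]
  exact congrFun₂ hX.form₁ i j

theorem two_mul_fst (a : Fin m) (j : Idx m l) :
    2 * X (fstIdx m l a) j = -midForm X (lstIdx m l a.rev) j := by
  simp [hX.midForm_eq, S₀_mulVec, S₁_mulVec]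

theorem two_mul_lst (a : Fin m) (j : Idx m l) :
    2 * X (lstIdx m l a) j = -midForm X (fstIdx m l a.rev) j := by
  simp [hX.midForm_eq, S₀_mulVec, S₁_mulVec]

theorem two_mul_mid (a : Fin l) (j : Idx m l) :
    2 * π * X (midIdx m l a) j = -midForm X (midIdx m l a.rev) j := by
  simp [hX.midForm_eq, S₀_mulVec, S₁_mulVec, mul_assoc]

theorem two_mul_sum_fst_mul_lst (j : Idx m l) :
    2 * ∑ a, X (fstIdx m l a) j * X (lstIdx m l a.rev) j = -(π * midForm X j j) := by
  have h₀ := congrFun₂ hX.form₀ j j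
  have h₁ := congrFun₂ hX.form₁ j j
  simp only [Matrix.sub_apply, Matrix.add_apply, Matrix.smul_apply, transpose_mul_S₀_mul_apply,
    transpose_mul_S₁_mul_apply, smul_eq_mul, Matrix.zero_apply] at h₀ h₁
  linear_combination h₀ + π * h₁

theorem midForm_mul_mid (j : Idx m l) (a b : Fin l) :
    midForm X j j * X (midIdx m l b) (midIdx m l a) =
      -(2 * π * (X (midIdx m l a.rev) j * X (midIdx m l b) j)) := by
  rw [hX.minors.midForm_mul_apply, ← mul_assoc, hX.two_mul_mid, Fin.rev_rev]
  ring

theorem isUnit_midForm (h2 : IsUnit (2 : R)) (hπ : IsUnit π) {i j : Idx m l}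
    (hij : IsUnit (X i j)) : IsUnit (midForm X j j) := by
  let J := (Ideal.span {midForm X j j}).radical
  have hmid (a : Fin l) : X (midIdx m l a) j ∈ J := by
    refine ⟨2, (Ideal.unit_mul_mem_iff_mem _ (h2.mul hπ)).1 ?_⟩
    have h := hX.midForm_mul_mid j a.rev a
    rw [Fin.rev_rev, ← pow_two, ← neg_eq_iff_eq_neg] at h
    exact h ▸ neg_mem (Ideal.mul_mem_right _ _ (Ideal.mem_span_singleton_self _))
  have hform (k : Idx m l) : -midForm X k j ∈ J :=
    neg_mem (sum_mem fun a _ => Ideal.mul_mem_left _ _ (hmid a.rev))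
  have hmem : X i j ∈ J := by
    obtain a | a | a := i
    · exact (Ideal.unit_mul_mem_iff_mem _ h2).1 (hX.two_mul_fst a j ▸ hform _)
    · exact hmid a
    · exact (Ideal.unit_mul_mem_iff_mem _ h2).1 (hX.two_mul_lst a j ▸ hform _)
  exact Ideal.span_singleton_eq_top.1 (Ideal.radical_eq_top.1 (J.eq_top_of_isUnit_mem hmem hij))

theorem trace_eq_zero {i j : Idx m l} (hij : IsUnit (X i j)) : X.trace = 0 := by
  rw [← hij.mul_right_eq_zero, Matrix.trace, Finset.mul_sum, ← Matrix.zero_apply i j, ← hX.sq,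
    Matrix.mul_apply]
  exact Finset.sum_congr rfl fun k _ => hX.minors i k j k

variable {j : Idx m l} (hj : IsUnit (midForm X j j))
include hj

theorem sum_mid_mid : ∑ a, X (midIdx m l a) (midIdx m l a) = -(2 * π) := by
  refine hj.mul_left_cancel ?_
  have h : ∑ a, X (midIdx m l a.rev) j * X (midIdx m l a) j = midForm X j j :=
    Finset.sum_congr rfl fun _ _ => mul_comm ..
  rw [Finset.mul_sum, Finset.sum_congr rfl fun a _ => hX.midForm_mul_mid j a a,
    Finset.sum_neg_distrib, ← Finset.mul_sum, h]
  ring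

theorem mid_symm (a b : Fin l) :
    X (midIdx m l a) (midIdx m l b.rev) = X (midIdx m l b) (midIdx m l a.rev) := by
  refine hj.mul_left_cancel ?_
  rw [hX.midForm_mul_mid, hX.midForm_mul_mid, Fin.rev_rev, Fin.rev_rev]
  ring

theorem sum_midForm_fst_lst : ∑ k, midForm X (fstIdx m l k) (lstIdx m l k.rev) = -(2 * π) := by
  refine hj.mul_left_cancel ?_
  calc midForm X j j * ∑ k, midForm X (fstIdx m l k) (lstIdx m l k.rev)
      = ∑ k, midForm X (fstIdx m l k) j * midForm X (lstIdx m l k.rev) j := by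
        simp only [Finset.mul_sum, hX.minors.midForm_mul_midForm]
    _ = ∑ k, 2 * (2 * (X (fstIdx m l k) j * X (lstIdx m l k.rev) j)) := by
        refine Finset.sum_congr rfl fun k _ => ?_
        have h := hX.two_mul_lst k.rev j
        rw [Fin.rev_rev] at h
        linear_combination midForm X (lstIdx m l k.rev) j * h -
          2 * X (lstIdx m l k.rev) j * hX.two_mul_fst k j
    _ = midForm X j j * -(2 * π) := by
        rw [← Finset.mul_sum, ← Finset.mul_sum, hX.two_mul_sum_fst_mul_lst]
        ring

theorem sum_lst_mul_fst (a b : Fin l) :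
    ∑ k, X (midIdx m l a) (lstIdx m l k.rev) * X (midIdx m l b) (fstIdx m l k) =
      X (midIdx m l a) (midIdx m l b.rev) := by
  refine hj.mul_left_cancel ?_
  calc midForm X j j * ∑ k, X (midIdx m l a) (lstIdx m l k.rev) * X (midIdx m l b) (fstIdx m l k)
      = (∑ k, midForm X (fstIdx m l k) (lstIdx m l k.rev)) *
          (X (midIdx m l a) j * X (midIdx m l b) j) := by
        rw [Finset.mul_sum, Finset.sum_mul]
        refine Finset.sum_congr rfl fun k _ => ?_
        rw [← mul_assoc, hX.minors.midForm_mul_apply, midForm_comm, mul_right_comm,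
          hX.minors.midForm_mul_apply]
        ring
    _ = midForm X j j * X (midIdx m l a) (midIdx m l b.rev) := by
        rw [hX.sum_midForm_fst_lst hj, hX.midForm_mul_mid, Fin.rev_rev]
        ring

omit hj in
theorem addRel (h2 : IsUnit (2 : R)) (hπ : IsUnit π) {i j : Idx m l} (hij : IsUnit (X i j)) :
    AddRel X π :=
  have hj := hX.isUnit_midForm h2 hπ hij
  { trace := hX.trace_eq_zero hij
    trace_mid := eq_neg_iff_add_eq_zero.1 (hX.sum_mid_mid hj)
    symm := hX.mid_symm hj
    mid := hX.sum_lst_mul_fst hj }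

end NaiveRel

end Relations

section OuterDetermined

variable {m l : ℕ} {R : Type*} [CommRing R]

/-- The equations expressing all entries of a matrix through those in the outer columns of the
middle rows, provided that `2` is invertible. -/
structure IsOuterDetermined (X : Matrix (Idx m l) (Idx m l) R) : Prop where
  mid a b : X (midIdx m l a) (midIdx m l b.rev) =
    ∑ k, X (midIdx m l a) (lstIdx m l k.rev) * X (midIdx m l b) (fstIdx m l k)
  two_mul_fst a j : 2 * X (fstIdx m l a) j = -midForm X (lstIdx m l a.rev) j
  two_mul_lst a j : 2 * X (lstIdx m l a) j = -midForm X (fstIdx m l a.rev) j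

/-- The entries of a matrix in the outer columns of the middle rows, that is, its blocks `B₁`
and `B₂`. -/
def outerBlock (X : Matrix (Idx m l) (Idx m l) R) : Fin l → Fin m ⊕ Fin m → R :=
  fun a => Sum.elim (fun k => X (midIdx m l a) (fstIdx m l k)) fun k =>
    X (midIdx m l a) (lstIdx m l k)

theorem MinorsVanish.outerBlock {X : Matrix (Idx m l) (Idx m l) R} (hX : MinorsVanish X) :
    MinorsVanish (outerBlock X) := by
  rintro a a' (k | k) (k' | k') <;> exact hX _ _ _ _

theorem NaiveRel.isOuterDetermined {X : Matrix (Idx m l) (Idx m l) R} {π : R}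
    (hX : NaiveRel X π) (hX' : AddRel X π) : IsOuterDetermined X :=
  ⟨fun a b => (hX'.mid a b).symm, hX.two_mul_fst, hX.two_mul_lst⟩

theorem IsOuterDetermined.prod {R' : Type*} [CommRing R'] {X : Matrix (Idx m l) (Idx m l) R}
    {X' : Matrix (Idx m l) (Idx m l) R'} (hX : IsOuterDetermined X) (hX' : IsOuterDetermined X') :
    IsOuterDetermined (Matrix.of fun i j => (X i j, X' i j)) where
  mid a b := by
    ext <;> simp [Prod.fst_sum, Prod.snd_sum, hX.mid, hX'.mid]
  two_mul_fst a j := by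
    ext <;> simp [midForm, Prod.fst_sum, Prod.snd_sum, hX.two_mul_fst, hX'.two_mul_fst]
  two_mul_lst a j := by
    ext <;> simp [midForm, Prod.fst_sum, Prod.snd_sum, hX.two_mul_lst, hX'.two_mul_lst]

theorem IsOuterDetermined.apply_mem {𝒪 : Type*} [CommRing 𝒪] [Algebra 𝒪 R] (h2 : IsUnit (2 : 𝒪))
    {X : Matrix (Idx m l) (Idx m l) R} (hX : IsOuterDetermined X) {A : Subalgebra 𝒪 R}
    (hA : ∀ a k, outerBlock X a k ∈ A) (i j : Idx m l) : X i j ∈ A := by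
  have half {x : R} (hx : 2 * x ∈ A) : x ∈ A := by
    obtain ⟨h, hh⟩ := h2.exists_left_inv
    have : x = h • (2 * x) := by
      rw [Algebra.smul_def, ← mul_assoc, ← map_ofNat (algebraMap 𝒪 R) 2, ← map_mul, hh, map_one,
        one_mul]
    exact this ▸ A.smul_mem hx h
  have hmid (a : Fin l) (j : Idx m l) : X (midIdx m l a) j ∈ A := by
    obtain k | b | k := j
    · exact hA a (Sum.inl k)
    · rw [← Fin.rev_rev b]
      exact hX.mid a b.rev ▸ sum_mem fun k _ =>
        mul_mem (hA a (Sum.inr k.rev)) (hA b.rev (Sum.inl k))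
    · exact hA a (Sum.inr k)
  have hform (k : Idx m l) : -midForm X k j ∈ A :=
    neg_mem (sum_mem fun a _ => mul_mem (hmid _ _) (hmid _ _))
  obtain a | a | a := i
  · exact half (hX.two_mul_fst a j ▸ hform _)
  · exact hmid a j
  · exact half (hX.two_mul_lst a j ▸ hform _)

end OuterDetermined

section RankOne

variable {m l : ℕ} {R : Type*} [CommRing R]

theorem transpose_vecMulVec_mul_mul_vecMulVec {ι : Type*} [Fintype ι] (z w : ι → R)
    (M : Matrix ι ι R) : (Matrix.vecMulVec z w)ᵀ * M * Matrix.vecMulVec z w =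
      (z ⬝ᵥ M *ᵥ z) • Matrix.vecMulVec w w := by
  rw [Matrix.transpose_vecMulVec, Matrix.vecMulVec_mul, Matrix.vecMulVec_mul_vecMulVec,
    ← Matrix.dotProduct_mulVec, Matrix.vecMulVec_smul]

/-- Indices of the parameters `(u, v₁, v₂)` of the rank-one matrices on the chart. -/
abbrev ParamIdx (m l : ℕ) : Type := Fin l ⊕ (Fin m ⊕ Fin m)

/-- The form `uᵗ J u`. -/
def uForm (p : ParamIdx m l → R) : R :=
  (fun b => p (Sum.inl b)) ⬝ᵥ fun b => p (Sum.inl b.rev)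

/-- The form `v₁ᵗ J v₂`. -/
def vForm (p : ParamIdx m l → R) : R :=
  (fun k => p (Sum.inr (Sum.inl k))) ⬝ᵥ fun k => p (Sum.inr (Sum.inr k.rev))

/-- The expression `uᵗ J u · v₁ᵗ J v₂ + 2π`, whose vanishing makes the rank-one matrix with
parameters `(u, v₁, v₂)` a point of the chart. -/
def quartic (π : R) (p : ParamIdx m l → R) : R :=
  uForm p * vForm p + 2 * π

/-- The column `(-(s/2) J v₂, u, -(s/2) J v₁)`, where `s = uᵗ J u` and `h` stands for `1/2`. -/
def colVec (h : R) (p : ParamIdx m l → R) : Idx m l → R :=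
  Sum.elim (fun a => -(h * uForm p) * p (Sum.inr (Sum.inr a.rev)))
    (Sum.elim (fun a => p (Sum.inl a)) fun a => -(h * uForm p) * p (Sum.inr (Sum.inl a.rev)))

/-- The row `(v₁, t J u, v₂)`, where `t = v₁ᵗ J v₂`. -/
def rowVec (p : ParamIdx m l → R) : Idx m l → R :=
  Sum.elim (fun a => p (Sum.inr (Sum.inl a)))
    (Sum.elim (fun a => vForm p * p (Sum.inl a.rev)) fun a => p (Sum.inr (Sum.inr a)))

/-- The point of the chart with parameters `(u, v₁, v₂)`, where `h` stands for `1/2`. -/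
def rankOne (h : R) (p : ParamIdx m l → R) : Matrix (Idx m l) (Idx m l) R :=
  Matrix.vecMulVec (colVec h p) (rowVec p)

theorem uForm_map {R' : Type*} [CommRing R'] (f : R →+* R') (p : ParamIdx m l → R) :
    f (uForm p) = uForm (f ∘ p) :=
  f.map_dotProduct _ _

theorem vForm_map {R' : Type*} [CommRing R'] (f : R →+* R') (p : ParamIdx m l → R) :
    f (vForm p) = vForm (f ∘ p) :=
  f.map_dotProduct _ _

theorem quartic_map {R' : Type*} [CommRing R'] (f : R →+* R') (π : R) (p : ParamIdx m l → R) :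
    f (quartic π p) = quartic (f π) (f ∘ p) := by
  simp only [quartic, map_add, map_mul, uForm_map, vForm_map, map_ofNat]

theorem rankOne_map {R' : Type*} [CommRing R'] (f : R →+* R') (h : R) (p : ParamIdx m l → R) :
    (rankOne h p).map f = rankOne (f h) (f ∘ p) := by
  ext (i | i | i) (j | j | j) <;>
    simp [rankOne, colVec, rowVec, Matrix.vecMulVec_apply, uForm_map, vForm_map]

theorem sum_rankOne_mid_mid (h : R) (p : ParamIdx m l → R) :
    ∑ a, rankOne h p (midIdx m l a) (midIdx m l a) = uForm p * vForm p := by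
  rw [uForm, dotProduct, Finset.sum_mul]
  exact Finset.sum_congr rfl fun a _ => by
    simp only [rankOne, colVec, rowVec, Matrix.vecMulVec_apply, Sum.elim_inl, Sum.elim_inr]
    ring

theorem midForm_rankOne (h : R) (p : ParamIdx m l → R) (i j : Idx m l) :
    midForm (rankOne h p) i j = uForm p * (rowVec p i * rowVec p j) := by
  rw [uForm, dotProduct, Finset.sum_mul]
  exact Finset.sum_congr rfl fun a _ => mul_mul_mul_comm ..

theorem vForm_comm (p : ParamIdx m l → R) :
    ∑ k : Fin m, p (Sum.inr (Sum.inr k)) * p (Sum.inr (Sum.inl k.rev)) = vForm p :=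
  sum_mul_rev_comm (fun k => p (Sum.inr (Sum.inr k))) fun k => p (Sum.inr (Sum.inl k))

variable {h : R} (hh : 2 * h = 1) {π : R} {p : ParamIdx m l → R}

theorem colVec_dotProduct_S₀_mulVec_colVec :
    colVec h p ⬝ᵥ S₀ R m l *ᵥ colVec h p = 2 * (h * uForm p) ^ 2 * vForm p := by
  have key : ∑ a, colVec h p (fstIdx m l a) * colVec h p (lstIdx m l a.rev) =
      (h * uForm p) ^ 2 * vForm p := by
    rw [← vForm_comm, Finset.mul_sum, ← Equiv.sum_comp Fin.revPerm]
    exact Finset.sum_congr rfl fun a _ => by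
      simp only [colVec, Fin.revPerm_apply, Sum.elim_inl, Sum.elim_inr, Fin.rev_rev]
      ring
  rw [dotProduct_S₀_mulVec, key]
  ring

theorem colVec_dotProduct_S₁_mulVec_colVec :
    colVec h p ⬝ᵥ S₁ R m l *ᵥ colVec h p = uForm p :=
  dotProduct_S₁_mulVec ..

include hh

theorem rankOne_isOuterDetermined : IsOuterDetermined (rankOne h p) where
  mid a b := by
    simp only [rankOne, colVec, rowVec, vForm, dotProduct, Matrix.vecMulVec_apply, Sum.elim_inl,
      Sum.elim_inr, Fin.rev_rev, Finset.mul_sum, Finset.sum_mul]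
    exact Finset.sum_congr rfl fun k _ => by ring
  two_mul_fst a j := by
    have hz : colVec h p (fstIdx m l a) = -(h * uForm p) * rowVec p (lstIdx m l a.rev) := rfl
    rw [midForm_rankOne, rankOne, Matrix.vecMulVec_apply, hz]
    linear_combination -(uForm p * rowVec p (lstIdx m l a.rev) * rowVec p j) * hh
  two_mul_lst a j := by
    have hz : colVec h p (lstIdx m l a) = -(h * uForm p) * rowVec p (fstIdx m l a.rev) := rfl
    rw [midForm_rankOne, rankOne, Matrix.vecMulVec_apply, hz]
    linear_combination -(uForm p * rowVec p (fstIdx m l a.rev) * rowVec p j) * hh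

theorem rowVec_dotProduct_colVec : rowVec p ⬝ᵥ colVec h p = 0 := by
  have hfst : ∑ a, rowVec p (fstIdx m l a) * colVec h p (fstIdx m l a) =
      -(h * uForm p) * vForm p := by
    rw [vForm, dotProduct, Finset.mul_sum]
    exact Finset.sum_congr rfl fun a _ => mul_left_comm ..
  have hmid : ∑ a, rowVec p (midIdx m l a) * colVec h p (midIdx m l a) = vForm p * uForm p := by
    rw [uForm, dotProduct, Finset.mul_sum]
    exact Finset.sum_congr rfl fun a _ => (mul_assoc ..).trans (congrArg _ (mul_comm ..))
  have hlst : ∑ a, rowVec p (lstIdx m l a) * colVec h p (lstIdx m l a) =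
      -(h * uForm p) * vForm p := by
    rw [← vForm_comm, Finset.mul_sum]
    exact Finset.sum_congr rfl fun a _ => mul_left_comm ..
  rw [dotProduct, Fintype.sum_sum_type, Fintype.sum_sum_type, hfst, hmid, hlst]
  linear_combination -(uForm p * vForm p) * hh

variable (hp : quartic π p = 0)
include hp

theorem S₀_add_S₁_mulVec_colVec :
    S₀ R m l *ᵥ colVec h p + π • S₁ R m l *ᵥ colVec h p = -(h * uForm p) • rowVec p := by
  rw [S₀_mulVec, S₁_mulVec]
  ext (a | a | a)
  · simp [colVec, rowVec]
  · rw [quartic] at hp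
    simp only [colVec, rowVec, Pi.add_apply, Pi.smul_apply, Sum.elim_inl, Sum.elim_inr,
      smul_eq_mul, zero_add]
    linear_combination h * p (Sum.inl a.rev) * hp - π * p (Sum.inl a.rev) * hh
  · simp [colVec, rowVec]

theorem rankOne_naiveRel : NaiveRel (rankOne h p) π := by
  have hS : S₀ R m l * rankOne h p + π • (S₁ R m l * rankOne h p) =
      -(h * uForm p) • Matrix.vecMulVec (rowVec p) (rowVec p) := by
    rw [rankOne, Matrix.mul_vecMulVec, Matrix.mul_vecMulVec, ← Matrix.smul_vecMulVec,
      ← Matrix.add_vecMulVec, S₀_add_S₁_mulVec_colVec hh hp, Matrix.smul_vecMulVec]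
  rw [quartic] at hp
  refine ⟨?_, fun i i' j j' => ?_, ?_, ?_⟩
  · rw [rankOne, Matrix.vecMulVec_mul_vecMulVec, rowVec_dotProduct_colVec hh, zero_smul,
      Matrix.vecMulVec_zero]
  · simp only [rankOne, Matrix.vecMulVec_apply]
    ring
  · rw [hS, rankOne, transpose_vecMulVec_mul_mul_vecMulVec, smul_smul, ← sub_smul,
      colVec_dotProduct_S₀_mulVec_colVec]
    convert zero_smul R _
    linear_combination 2 * h ^ 2 * uForm p * hp - 2 * π * h * uForm p * hh
  · rw [hS, rankOne, transpose_vecMulVec_mul_mul_vecMulVec, smul_smul, ← add_smul,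
      colVec_dotProduct_S₁_mulVec_colVec]
    convert zero_smul R _
    linear_combination -uForm p * hh

theorem rankOne_addRel : AddRel (rankOne h p) π where
  trace := by
    rw [rankOne, Matrix.trace_vecMulVec, dotProduct_comm, rowVec_dotProduct_colVec hh]
  trace_mid := by rw [sum_rankOne_mid_mid]; exact hp
  symm a b := by
    simp only [rankOne, colVec, rowVec, Matrix.vecMulVec_apply, Sum.elim_inl, Sum.elim_inr,
      Fin.rev_rev]
    ring
  mid a b := ((rankOne_isOuterDetermined hh).mid a b).symm

end RankOne

section Ideals

variable {m l : ℕ} {R R' : Type*} [CommRing R] [CommRing R']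

theorem entries_subset_ker_iff {ι κ : Type*} (f : R →+* R') (M : Matrix ι κ R) :
    entries M ⊆ (RingHom.ker f : Set R) ↔ M.map f = 0 := by
  rw [entries, Set.range_subset_iff, ← Matrix.ext_iff]
  exact Prod.forall

theorem minors₂_subset_ker_iff {ι κ : Type*} (f : R →+* R') (M : Matrix ι κ R) :
    minors₂ M ⊆ (RingHom.ker f : Set R) ↔ MinorsVanish (M.map f) := by
  simp only [minors₂, MinorsVanish, Set.range_subset_iff, Prod.forall, SetLike.mem_coe,
    RingHom.mem_ker, map_sub, map_mul, sub_eq_zero, Matrix.map_apply]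

theorem smul_map {ι κ : Type*} (f : R →+* R') (c : R) (M : Matrix ι κ R) :
    (c • M).map f = f c • M.map f := by
  ext i j
  simp

theorem antidiag_map (f : R →+* R') (k : ℕ) : (antidiag R k).map f = antidiag R' k := by
  ext i j
  simp [antidiag, apply_ite f]

theorem S₀_map (f : R →+* R') : (S₀ R m l).map f = S₀ R' m l := by
  ext (i | i | i) (j | j | j) <;> simp [S₀, antidiag, apply_ite f]

theorem S₁_map (f : R →+* R') : (S₁ R m l).map f = S₁ R' m l := by
  ext (i | i | i) (j | j | j) <;> simp [S₁, antidiag, apply_ite f]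

variable {𝒪 : Type*} [CommRing 𝒪] (π : 𝒪)

theorem naiveIdeal_le_ker_iff (f : PolyRing 𝒪 m l →+* R) :
    naiveIdeal m l π ≤ RingHom.ker f ↔
      NaiveRel ((genericX 𝒪 m l).map f) (f (MvPolynomial.C π)) := by
  simp only [naiveIdeal, Ideal.span_le, Set.union_subset_iff, entries_subset_ker_iff,
    minors₂_subset_ker_iff, Matrix.map_sub f (map_sub f), Matrix.map_add f (map_add f),
    Matrix.map_mul, smul_map, map_mul, map_ofNat, Matrix.transpose_map, S₀_map, S₁_map]
  exact ⟨fun h => ⟨h.1.1.1, h.1.1.2, h.1.2, h.2⟩, fun h => ⟨⟨⟨h.1, h.2⟩, h.3⟩, h.4⟩⟩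

theorem addIdeal_le_ker_iff (f : PolyRing 𝒪 m l →+* R) :
    addIdeal m l π ≤ RingHom.ker f ↔
      AddRel ((genericX 𝒪 m l).map f) (f (MvPolynomial.C π)) := by
  simp only [addIdeal, Ideal.span_le, Set.union_subset_iff, entries_subset_ker_iff,
    Set.singleton_subset_iff, SetLike.mem_coe, RingHom.mem_ker, map_add,
    Matrix.map_sub f (map_sub f), Matrix.map_mul, map_mul, map_ofNat, Matrix.transpose_map,
    antidiag_map, AddMonoidHom.map_trace, blockA, blockB₁, blockB₂, ← Matrix.submatrix_map,
    sub_eq_zero, ← Matrix.ext_iff, mul_antidiag, antidiag_mul, Matrix.mul_apply (M := _ * _)]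
  exact ⟨fun h => ⟨h.1.1.1, h.1.1.2, h.1.2, h.2⟩, fun h => ⟨⟨⟨h.1, h.2⟩, h.3⟩, h.4⟩⟩

theorem chartIdeal_le_ker_iff (f : PolyRing 𝒪 m l →+* R) :
    chartIdeal m l π ≤ RingHom.ker f ↔
      NaiveRel ((genericX 𝒪 m l).map f) (f (MvPolynomial.C π)) ∧
        AddRel ((genericX 𝒪 m l).map f) (f (MvPolynomial.C π)) := by
  rw [chartIdeal, Submodule.add_eq_sup, sup_le_iff, naiveIdeal_le_ker_iff, addIdeal_le_ker_iff]

variable (m l) in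
/-- The matrix of the coordinate functions `x_{i,j}` on the chart. -/
noncomputable def chartMatrix : Matrix (Idx m l) (Idx m l) (ChartRing m l π) :=
  (genericX 𝒪 m l).map (Ideal.Quotient.mk (chartIdeal m l π))

variable (m l) in
theorem chartMatrix_rel : NaiveRel (chartMatrix m l π) (algebraMap 𝒪 (ChartRing m l π) π) ∧
    AddRel (chartMatrix m l π) (algebraMap 𝒪 (ChartRing m l π) π) :=
  (chartIdeal_le_ker_iff π _).1 Ideal.mk_ker.ge

theorem mem_closureIdeal_iff {J : Ideal R} {g f : R} :
    f ∈ closureIdeal J g ↔ ∃ N : ℕ, g ^ N * f ∈ J := by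
  rw [closureIdeal, RingHom.mem_ker, RingHom.comp_apply,
    IsLocalization.map_eq_zero_iff (Submonoid.powers (Ideal.Quotient.mk J g))]
  constructor
  · rintro ⟨⟨_, N, rfl⟩, h⟩
    exact ⟨N, by rw [← Ideal.Quotient.eq_zero_iff_mem]; simpa using h⟩
  · rintro ⟨N, h⟩
    exact ⟨⟨_, N, rfl⟩, by simpa using Ideal.Quotient.eq_zero_iff_mem.2 h⟩

theorem le_closureIdeal (J : Ideal R) (g : R) : J ≤ closureIdeal J g := fun f hf =>
  mem_closureIdeal_iff.2 ⟨0, by simpa using hf⟩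

theorem addIdeal_le_closureIdeal (h2 : IsUnit (2 : 𝒪)) (p : Idx m l × Idx m l) :
    addIdeal m l π ≤
      closureIdeal (naiveIdeal m l π) (MvPolynomial.C π * MvPolynomial.X p) := by
  let g := Ideal.Quotient.mk (naiveIdeal m l π) (MvPolynomial.C π * MvPolynomial.X p)
  let f := (algebraMap _ (Localization.Away g)).comp (Ideal.Quotient.mk (naiveIdeal m l π))
  have hN : NaiveRel ((genericX 𝒪 m l).map f) (f (MvPolynomial.C π)) :=
    (naiveIdeal_le_ker_iff π f).1 (le_closureIdeal _ _)
  have hf : IsUnit (f (MvPolynomial.C π * MvPolynomial.X p)) :=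
    IsLocalization.Away.algebraMap_isUnit g
  rw [map_mul] at hf
  have h2' : IsUnit (2 : Localization.Away g) :=
    map_ofNat (algebraMap 𝒪 (Localization.Away g)) 2 ▸ h2.map (algebraMap 𝒪 _)
  exact (addIdeal_le_ker_iff π f).2 (hN.addRel h2' (isUnit_of_mul_isUnit_left hf)
    (i := p.1) (j := p.2) (isUnit_of_mul_isUnit_right hf))

theorem eq_zero_of_forall_exists_pow_mul_eq_zero {ι : Type*} {x : ι → R} {y c : R}
    (hx : ∀ i, ∃ N : ℕ, x i ^ N * y = 0) (hc : c ∈ nonZeroDivisors R)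
    (hcx : c ∈ Ideal.span (Set.range x)) : y = 0 := by
  have hle : Ideal.span (Set.range x) ≤ (Ideal.span {y}).annihilator.radical := by
    rw [Ideal.span_le, Set.range_subset_iff]
    exact fun i => (hx i).imp fun N hN => Submodule.mem_annihilator_span_singleton y _ |>.2 hN
  obtain ⟨N, hN⟩ := hle hcx
  exact (mul_left_mem_nonZeroDivisors_eq_zero_iff (pow_mem hc N)).1
    ((Submodule.mem_annihilator_span_singleton y _).1 hN)

theorem chartIdeal_eq_iInf_closureIdeal (h2 : IsUnit (2 : 𝒪))
    (hπ : algebraMap 𝒪 (ChartRing m l π) π ∈ nonZeroDivisors (ChartRing m l π)) :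
    chartIdeal m l π = ⨅ p : Idx m l × Idx m l,
      closureIdeal (naiveIdeal m l π) (MvPolynomial.C π * MvPolynomial.X p) := by
  refine le_antisymm (le_iInf fun p => sup_le (le_closureIdeal _ _)
    (addIdeal_le_closureIdeal π h2 p)) fun f hf => ?_
  rw [Ideal.mem_iInf] at hf
  set mk := Ideal.Quotient.mk (chartIdeal m l π)
  rw [← Ideal.Quotient.eq_zero_iff_mem]
  have hpow (p : Idx m l × Idx m l) : ∃ N : ℕ, mk (MvPolynomial.X p) ^ N * mk f = 0 := by
    obtain ⟨N, hN⟩ := mem_closureIdeal_iff.1 (hf p)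
    have h : mk _ = 0 := Ideal.Quotient.eq_zero_iff_mem.2
      (le_sup_left (a := naiveIdeal m l π) (b := addIdeal m l π) hN)
    rw [mul_pow, mul_assoc, map_mul, map_pow] at h
    refine ⟨N, ?_⟩
    simpa using (mul_left_mem_nonZeroDivisors_eq_zero_iff (pow_mem hπ N)).1 h
  have h2' : IsUnit (2 : ChartRing m l π) :=
    map_ofNat (algebraMap 𝒪 (ChartRing m l π)) 2 ▸ h2.map (algebraMap 𝒪 (ChartRing m l π))
  refine eq_zero_of_forall_exists_pow_mul_eq_zero hpow (mul_mem h2'.mem_nonZeroDivisors hπ) ?_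
  have h2π := eq_neg_of_add_eq_zero_right (chartMatrix_rel m l π).2.trace_mid
  exact h2π ▸ neg_mem (sum_mem fun a _ => Ideal.subset_span ⟨(midIdx m l a, midIdx m l a), rfl⟩)

end Ideals

section Flat

variable {m l : ℕ} {𝒪 : Type*} [CommRing 𝒪]

theorem exists_dotProduct_rev_eq_one {k : ℕ} (hk : 0 < k) (h2 : IsUnit (2 : 𝒪)) :
    ∃ ξ : Fin k → 𝒪, ξ ⬝ᵥ (fun i => ξ i.rev) = 1 := by
  obtain ⟨h, hh⟩ := h2.exists_right_inv
  let i : Fin k := ⟨0, hk⟩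
  by_cases hi : i.rev = i
  · exact ⟨Pi.single i 1, by simp [hi]⟩
  · refine ⟨Pi.single i 1 + Pi.single i.rev h, ?_⟩
    simp [hi, Ne.symm hi, ← two_mul, hh, add_dotProduct]

theorem flat_quotient_quartic (h2 : IsUnit (2 : 𝒪)) (hm : 0 < m) (hl : 0 < l) (π : 𝒪) :
    Module.Flat 𝒪 (MvPolynomial (ParamIdx m l) 𝒪 ⧸
      Ideal.span {quartic (MvPolynomial.C π) (MvPolynomial.X (R := 𝒪) (σ := ParamIdx m l))}) := by
  nontriviality 𝒪
  obtain ⟨ξ, hξ⟩ := exists_dotProduct_rev_eq_one hl h2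
  let k : Fin m := ⟨0, hm⟩
  let ω : ParamIdx m l → MvPolynomial (ParamIdx m l) 𝒪 :=
    MvPolynomial.C ∘ Sum.elim ξ (Sum.elim (Pi.single k 1) (Pi.single k.rev 1))
  have hu : uForm ω = 1 := by
    rw [← uForm_map]
    exact (congrArg _ hξ).trans (map_one _)
  have hv : vForm ω = 1 := by
    rw [← vForm_map]
    simp [vForm]
  let line : ParamIdx m l → Polynomial (MvPolynomial (ParamIdx m l) 𝒪) := fun i =>
    .C (.X i) + .C (ω i) * .X
  let θ : MvPolynomial (ParamIdx m l) 𝒪 →ₐ[𝒪] Polynomial (MvPolynomial (ParamIdx m l) 𝒪) :=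
    MvPolynomial.aeval line
  have hθX : θ ∘ MvPolynomial.X = line := funext (MvPolynomial.aeval_X line)
  have hθ (a) : (θ a).eval 0 = a := by
    have : ((Polynomial.aeval 0).restrictScalars 𝒪).comp θ = AlgHom.id 𝒪 _ :=
      MvPolynomial.algHom_ext fun i => by simp [θ, line]
    exact (DFunLike.congr_fun this a :)
  refine flat_quotient_span_singleton_of_monic θ hθ ?_
  have hθq : θ (quartic (MvPolynomial.C π) MvPolynomial.X) =
      uForm line * vForm line + .C (MvPolynomial.C (2 * π)) := by
    rw [← RingHom.coe_coe, quartic_map, RingHom.coe_coe, hθX, quartic]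
    simp only [θ, MvPolynomial.algHom_C, IsScalarTower.algebraMap_apply 𝒪
      (MvPolynomial (ParamIdx m l) 𝒪) (Polynomial _), MvPolynomial.algebraMap_eq,
      Polynomial.algebraMap_eq, map_mul, map_ofNat]
  obtain ⟨humonic, hudeg⟩ := monic_dotProduct_line hu (p := uForm line) rfl
  obtain ⟨hvmonic, hvdeg⟩ := monic_dotProduct_line hv (p := vForm line) rfl
  rw [hθq]
  refine (humonic.mul hvmonic).add_of_left (Polynomial.degree_C_le.trans_lt ?_)
  rw [← Polynomial.natDegree_pos_iff_degree_pos, humonic.natDegree_mul hvmonic, hudeg, hvdeg]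
  norm_num

/-- The homomorphism `x_{i,j} ↦ z_i w_j` of the parametrization by rank-one matrices `z wᵗ`, where
`h` stands for `1/2`. -/
noncomputable def rankOneHom (m l : ℕ) (h : 𝒪) :
    PolyRing 𝒪 m l →ₐ[𝒪] MvPolynomial (ParamIdx m l) 𝒪 :=
  MvPolynomial.aeval fun p => rankOne (MvPolynomial.C h) MvPolynomial.X p.1 p.2

theorem rankOneHom_X (h : 𝒪) (p : Idx m l × Idx m l) : rankOneHom m l h (MvPolynomial.X p) =
    rankOne (MvPolynomial.C h) MvPolynomial.X p.1 p.2 :=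
  MvPolynomial.aeval_X ..

theorem rankOneHom_C (h c : 𝒪) :
    rankOneHom m l h (MvPolynomial.C c) = MvPolynomial.C c :=
  MvPolynomial.aeval_C ..

theorem rankOneHom_trace_mid (h π : 𝒪) : rankOneHom m l h
    (∑ a, MvPolynomial.X (midIdx m l a, midIdx m l a) + 2 * MvPolynomial.C π) =
      quartic (MvPolynomial.C π) MvPolynomial.X := by
  simp only [map_add, map_sum, map_mul, map_ofNat, rankOneHom_X, rankOneHom_C,
    sum_rankOne_mid_mid, quartic]

variable (m l) (π : 𝒪) in
/-- The linear map from the polynomial ring in the parameters `(u, v₁, v₂)` to the coordinate ring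
of the chart that sends a monomial to the product of the corresponding entries `u_a v_b` of `B₁`
and `B₂`. -/
noncomputable def chartRetraction :
    MvPolynomial (ParamIdx m l) 𝒪 →ₗ[𝒪] ChartRing m l π :=
  segreRetraction 𝒪 (outerBlock (chartMatrix m l π))

variable {π h : 𝒪} (hh : 2 * h = 1)
include hh

theorem two_mul_C {σ : Type*} : 2 * (MvPolynomial.C h : MvPolynomial σ 𝒪) = 1 := by
  rw [← map_ofNat MvPolynomial.C 2, ← map_mul, hh, map_one]

theorem chartRetraction_rankOneHom_mul (e : PolyRing 𝒪 m l)
    (g : MvPolynomial (ParamIdx m l) 𝒪) : chartRetraction m l π (rankOneHom m l h e * g) =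
      Ideal.Quotient.mk (chartIdeal m l π) e * chartRetraction m l π g := by
  obtain ⟨hN, hA⟩ := chartMatrix_rel m l π
  have hX := (rankOne_isOuterDetermined (p := MvPolynomial.X) (two_mul_C hh)).prod
    (hN.isOuterDetermined hA)
  have h2 : IsUnit (2 : 𝒪) := .of_mul_eq_one h hh
  have hmem := hX.apply_mem h2 (A := intertwiners (chartRetraction m l π)) <| by
    rintro a (k | k) g <;> exact hN.minors.outerBlock.segreRetraction_X_mul_X_mul 𝒪 a _ g
  let f := (rankOneHom m l h).prod (Ideal.Quotient.mkₐ 𝒪 (chartIdeal m l π))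
  suffices f e ∈ intertwiners (chartRetraction m l π) from this g
  induction e using MvPolynomial.induction_on with
  | C c => exact f.commutes c ▸ Subalgebra.algebraMap_mem _ c
  | add e e' he he' => exact map_add f e e' ▸ add_mem he he'
  | mul_X e p he =>
    have hp : f (MvPolynomial.X p) ∈ intertwiners (chartRetraction m l π) := by
      convert hmem p.1 p.2 using 1
      exact Prod.ext (rankOneHom_X h p) rfl
    exact map_mul f e _ ▸ mul_mem he hp

theorem chartIdeal_le_comap_rankOneHom : chartIdeal m l π ≤
    (Ideal.span {quartic (MvPolynomial.C π) MvPolynomial.X}).comap (rankOneHom m l h) := by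
  let q := Ideal.span {quartic (MvPolynomial.C π) (MvPolynomial.X (R := 𝒪) (σ := ParamIdx m l))}
  let f := (Ideal.Quotient.mk q).comp (rankOneHom m l h : PolyRing 𝒪 m l →+* _)
  have hf : f (MvPolynomial.C π) = Ideal.Quotient.mk q (MvPolynomial.C π) :=
    congrArg _ (rankOneHom_C h π)
  have hX : (genericX 𝒪 m l).map f =
      rankOne (Ideal.Quotient.mk q (MvPolynomial.C h)) (Ideal.Quotient.mk q ∘ MvPolynomial.X) := by
    rw [← rankOne_map]
    ext i j
    exact congrArg _ (rankOneHom_X h (i, j))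
  have hq : quartic (f (MvPolynomial.C π)) (Ideal.Quotient.mk q ∘ MvPolynomial.X) = 0 := by
    rw [hf, ← quartic_map, Ideal.Quotient.eq_zero_iff_mem]
    exact Ideal.mem_span_singleton_self _
  have hh' : 2 * Ideal.Quotient.mk q (MvPolynomial.C h) = 1 := by
    rw [← map_ofNat (Ideal.Quotient.mk q) 2, ← map_mul, two_mul_C hh, map_one]
  have hle := (chartIdeal_le_ker_iff π f).2
    (hX ▸ ⟨rankOne_naiveRel hh' hq, rankOne_addRel hh' hq⟩)
  rwa [← RingHom.comap_ker, Ideal.mk_ker] at hle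

theorem chartRetraction_eq_zero {g : MvPolynomial (ParamIdx m l) 𝒪}
    (hg : g ∈ Ideal.span {quartic (MvPolynomial.C π) MvPolynomial.X}) :
    chartRetraction m l π g = 0 := by
  obtain ⟨g, rfl⟩ := Ideal.mem_span_singleton.1 hg
  have htr : Ideal.Quotient.mk (chartIdeal m l π)
      (∑ a, MvPolynomial.X (midIdx m l a, midIdx m l a) + 2 * MvPolynomial.C π) = 0 := by
    rw [map_add, map_sum, map_mul, map_ofNat]
    exact (chartMatrix_rel m l π).2.trace_mid
  rw [← rankOneHom_trace_mid h, chartRetraction_rankOneHom_mul hh, htr, zero_mul]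

omit hh in
theorem flat_chartRing (h2 : IsUnit (2 : 𝒪)) (hm : 0 < m) (hl : 0 < l) (π : 𝒪) :
    Module.Flat 𝒪 (ChartRing m l π) := by
  obtain ⟨h, hh⟩ := h2.exists_right_inv
  let q := Ideal.span {quartic (MvPolynomial.C π) (MvPolynomial.X (R := 𝒪) (σ := ParamIdx m l))}
  have : Module.Flat 𝒪 (MvPolynomial (ParamIdx m l) 𝒪 ⧸ q) := flat_quotient_quartic h2 hm hl π
  let i : ChartRing m l π →ₐ[𝒪] MvPolynomial (ParamIdx m l) 𝒪 ⧸ q :=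
    Ideal.quotientMapₐ q (rankOneHom m l h) (chartIdeal_le_comap_rankOneHom hh)
  let r : (MvPolynomial (ParamIdx m l) 𝒪 ⧸ q) →ₗ[𝒪] ChartRing m l π :=
    (q.restrictScalars 𝒪).liftQ (chartRetraction m l π) fun _ => chartRetraction_eq_zero hh
  refine .of_retract i.toLinearMap r (LinearMap.ext fun x => ?_)
  obtain ⟨e, rfl⟩ := Ideal.Quotient.mk_surjective x
  have hr := chartRetraction_rankOneHom_mul (π := π) hh e 1
  rw [mul_one, chartRetraction, segreRetraction_one, mul_one] at hr
  exact hr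

end Flat

end OrthogonalChart

open OrthogonalChart in
theorem theorem5p4_general {𝒪 : Type*} [CommRing 𝒪] (h2 : IsUnit (2 : 𝒪)) {π : 𝒪}
    (hπ : π ∈ nonZeroDivisors 𝒪) {m l : ℕ} (hm : 0 < m) (hl : 0 < l) :
    AlgebraicGeometry.Flat (chartStructure m l π) ∧
    algebraMap 𝒪 (ChartRing m l π) π ∈ nonZeroDivisors (ChartRing m l π) ∧
    chartIdeal m l π = ⨅ p : Idx m l × Idx m l,
      closureIdeal (naiveIdeal m l π) (MvPolynomial.C π * MvPolynomial.X p) := by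
  have hflat := flat_chartRing h2 hm hl π
  have hnzd : algebraMap 𝒪 (ChartRing m l π) π ∈ nonZeroDivisors (ChartRing m l π) := by
    refine mem_nonZeroDivisors_iff_right.2 fun x hx => ?_
    refine (Module.Flat.isSMulRegular_of_nonZeroDivisors hπ).right_eq_zero_of_smul ?_
    exact (Algebra.smul_def π x).trans (hx ▸ mul_comm _ x)
  refine ⟨AlgebraicGeometry.Flat.SpecMap_iff.2 ?_, hnzd,
    chartIdeal_eq_iInf_closureIdeal π h2 hnzd⟩
  rwa [CommRingCat.hom_ofHom, RingHom.flat_algebraMap_iff]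

open OrthogonalChart in
theorem theorem5p4 {𝒪 : Type*} [CommRing 𝒪] [IsDomain 𝒪] [IsDiscreteValuationRing 𝒪]
    (h2 : IsUnit (2 : 𝒪)) (π : 𝒪) (hπ : Irreducible π)
    (d l n r : ℕ) (hdn : d = 2 * n) (hlr : l = 2 * r)
    (hd : 5 ≤ d) (hl : 1 < l) (hl' : l + 1 < d) :
    AlgebraicGeometry.Flat (chartStructure (n - r) l π) ∧
    algebraMap 𝒪 (ChartRing (n - r) l π) π ∈ nonZeroDivisors (ChartRing (n - r) l π) ∧
    chartIdeal (n - r) l π =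
      ⨅ p : Idx (n - r) l × Idx (n - r) l,
        closureIdeal (naiveIdeal (n - r) l π) (MvPolynomial.C π * MvPolynomial.X p) :=
  theorem5p4_general h2 (mem_nonZeroDivisors_of_ne_zero hπ.ne_zero) (by omega) (by omega)
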